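/- Let $\mathcal R_{omin}=\langle R;<,+,\dots\rangle$ be an o-minimal expansion of an ordered abelian group, i.e. every subset of $R$ definable in $\mathcal R_{omin}$ is a finite union of points and open intervals with end points in $R\cup\{\pm\infty\}$. Here and below, "definable" means definable with parameters, and "$\emptyset$-definable" means definable without parameters. Call a subset of $R$ bounded if it has a lower and an upper bound in $R$, and co-bounded if its complement in $R$ is bounded. Let $\mathcal M=\langle R;+,\dots\rangle$ be a reduct of $\mathcal R_{omin}$, i.e. a structure on the same universe $R$, expanding $\langle R;+\rangle$, such that every subset of every $R^n$ that is definable in $\mathcal M$ is definable in $\mathcal R_{omin}$. Assume that $\mathcal M$ is strongly bounded, i.e. every subset of $R$ definable in $\mathcal M$ is bounded or co-bounded. Let $\mathrm{acl}_{\mathcal M}(\emptyset)$ be the union of all finite subsets of $R$ that are $\emptyset$-definable in $\mathcal M$. Assume that $\mathrm{acl}_{\mathcal M}(\emptyset)$ contains a nonzero element, and that for all $a,b\in \mathrm{acl}_{\mathcal M}(\emptyset)$ the restriction of $<$ to the interval $(a,b)$ is $\emptyset$-definable in $\mathcal M$. Let $g$ be a partial function from $R$ to $R$ that is definable in $\mathcal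 M$, whose domain is co-bounded and whose image is bounded. Then $g$ is constant on a co-bounded set, i.e. there are a co-bounded set $S\subseteq \mathrm{dom}(g)$ and $c\in R$ with $g(x)=c$ for all $x\in S$. -/

import Mathlib

namespace StronglyBounded



universe u v u' v' w

section OrderedSets

variable {R : Type w} [LinearOrder R]

/-- A subset of a linear order is bounded if it is bounded from below and from above. -/
def Bounded (s : Set R) : Prop := BddBelow s ∧ BddAbove s

/-- A subset is co-bounded if its complement is bounded. -/
def CoBounded (s : Set R) : Prop := Bounded sᶜ

/-- The cells on the line: singletons, and open intervals with end points
in `R ∪ {-∞, +∞}`. -/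
inductive IsCell : Set R → Prop
  | point (a : R) : IsCell {a}
  | ioo (a b : R) : IsCell (Set.Ioo a b)
  | iio (b : R) : IsCell (Set.Iio b)
  | ioi (a : R) : IsCell (Set.Ioi a)
  | univ : IsCell Set.univ

end OrderedSets

section Structures

variable (L : FirstOrder.Language.{u, v}) (L' : FirstOrder.Language.{u', v'}) (R : Type w)

/-- Every set in one variable that is definable with parameters is a finite union of points
and open intervals with end points in `R ∪ {-∞, +∞}`. -/
def IsOMinimal [L.Structure R] [LinearOrder R] : Prop :=
  ∀ s : Set R, (Set.univ : Set R).Definable₁ L s →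
    ∃ C : Set (Set R), C.Finite ∧ (∀ c ∈ C, IsCell c) ∧ s = ⋃₀ C

/-- `R` as an `L`-structure is a reduct of `R` as an `L'`-structure: every set definable with
parameters in the former is definable with parameters in the latter. -/
def IsReduct [L.Structure R] [L'.Structure R] : Prop :=
  ∀ (n : ℕ) (s : Set (Fin n → R)),
    (Set.univ : Set R).Definable L s → (Set.univ : Set R).Definable L' s

/-- The `L`-structure on `R` is strongly bounded: every set in one variable that is definable
with parameters is bounded or co-bounded. -/
def IsStronglyBounded [L.Structure R] [LinearOrder R] : Prop :=
  ∀ s : Set R, (Set.univ : Set R).Definable₁ L s → Bounded s ∨ CoBounded s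

/-- The strict order is definable over `A`. -/
def LtDefinable [L.Structure R] [LinearOrder R] (A : Set R) : Prop :=
  A.Definable₂ L {p : R × R | p.1 < p.2}

/-- The graph of addition is definable over `A`. -/
def AddDefinable [L.Structure R] [Add R] (A : Set R) : Prop :=
  A.Definable L {x : Fin 3 → R | x 0 + x 1 = x 2}

/-- The model-theoretic algebraic closure of `A`: the elements of finite `A`-definable sets. -/
def acl [L.Structure R] (A : Set R) : Set R :=
  {a | ∃ s : Set R, A.Definable₁ L s ∧ s.Finite ∧ a ∈ s}

/-- The restriction of the strict order to each interval `(a, b)` with `a, b ∈ acl(∅)` is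
definable without parameters. -/
def LtDefinableOnEmptyIntervals [L.Structure R] [LinearOrder R] : Prop :=
  ∀ a ∈ acl L R ∅, ∀ b ∈ acl L R ∅,
    (∅ : Set R).Definable₂ L
      {p : R × R | p.1 ∈ Set.Ioo a b ∧ p.2 ∈ Set.Ioo a b ∧ p.1 < p.2}

end Structures

end StronglyBounded

/-!
O-minimality enters through two facts about definable subsets of the line. Such a set is a finite
union of order-connected sets, so if it meets every neighbourhood of an end of the line, or every
left neighbourhood of a point, then it contains such a neighbourhood. If it is nonempty and bounded
above, then it has a supremum.

Extend `g` by `0` to a total function `f`. Being bounded near `±∞`, `f` has limits `l` and `l'`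
there (`IsOMinimal.exists_tendsto_atTop`). Let `c > 0` be in `acl(∅)`. The order on `(-c, c)` is
definable in the reduct, hence so are the short intervals around every point. If `l ≠ l'`, then the
preimage of a short interval around `l` contains a neighbourhood of one end of the line and misses
one of the other, against strong boundedness (`IsStronglyBounded.tendsto_unique`).

So `l = l'`, and after subtracting `l` the function tends to `0` at both ends. By strong
boundedness, off a bounded set it is `0`, or positive, or negative, and up to a sign it remains to
exclude that it is positive. Suppose it is. At arbitrarily large `y`, the values just to the left
of `y` exceed those just to the right (`IsOMinimal.frequently_drop`). The set of such `y` is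
definable in the reduct, because only points and values at distance less than `c` are compared, so
it is co-bounded. The reflected argument shows that the set of `y` at which the values to the left
are smaller than those to the right is co-bounded too, and the two sets are disjoint
(`IsStronglyBounded.not_pos_of_tendsto_zero`).
-/

namespace StronglyBounded

open Set Filter Topology

/-! ### Definable predicates and functions -/

section Definability

variable {R : Type*} {L : FirstOrder.Language} [L.Structure R] {A : Set R} {α : Type*}

/-- Quantification over one further variable, the variable `none`, preserves definability. -/
theorem definable_exists {P : (α → R) → R → Prop}
    (h : A.Definable L {w : Option α → R | P (w ∘ some) (w none)}) :
    A.Definable L {v : α → R | ∃ x, P v x} := by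
  have h' := Definable.exists_of_finite (α := α) (β := Unit)
    (h.preimage_comp (fun o => o.elim (Sum.inr ()) Sum.inl))
  convert h' using 1
  ext v
  exact ⟨fun ⟨x, hx⟩ => ⟨fun _ => x, hx⟩, fun ⟨u, hu⟩ => ⟨u (), hu⟩⟩

theorem definable_not {P : (α → R) → Prop} (h : A.Definable L {v | P v}) :
    A.Definable L {v | ¬ P v} := h.compl

theorem definable_and {P Q : (α → R) → Prop} (h : A.Definable L {v | P v})
    (h' : A.Definable L {v | Q v}) : A.Definable L {v | P v ∧ Q v} := h.inter h'

theorem definable_or {P Q : (α → R) → Prop} (h : A.Definable L {v | P v})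
    (h' : A.Definable L {v | Q v}) : A.Definable L {v | P v ∨ Q v} := h.union h'

theorem definable_imp {P Q : (α → R) → Prop} (h : A.Definable L {v | P v})
    (h' : A.Definable L {v | Q v}) : A.Definable L {v | P v → Q v} := by
  simpa only [imp_iff_not_or] using definable_or (definable_not h) h'

theorem definable_forall {P : (α → R) → R → Prop}
    (h : A.Definable L {w : Option α → R | P (w ∘ some) (w none)}) :
    A.Definable L {v : α → R | ∀ x, P v x} := by
  simpa only [not_exists, not_not] using
    definable_not (definable_exists (P := fun v x => ¬ P v x) (definable_not h))

theorem definable_rel {S : Set (R × R)} (hS : A.Definable₂ L S) {s t : (α → R) → R}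
    (hs : A.DefinableFun L s) (ht : A.DefinableFun L t) :
    A.Definable L {v | (s v, t v) ∈ S} := by
  have hF : A.DefinableMap L (fun v => ![s v, t v]) := by
    simp [DefinableMap, *]
  exact Definable.preimage_map hF hS

theorem definable_pred {S : Set R} (hS : A.Definable₁ L S) {s : (α → R) → R}
    (hs : A.DefinableFun L s) : A.Definable L {v | s v ∈ S} :=
  Definable.preimage_map (F := fun v _ => s v) (fun _ => hs) hS

theorem definableFun_const (a : R) : (univ : Set R).DefinableFun L (fun _ : α → R => a) :=
  L.definableFun_const α (mem_univ a)

theorem definableFun_comp {f : R → R} (hf : A.DefinableFun L (fun v : Fin 1 → R => f (v 0)))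
    {t : (α → R) → R} (ht : A.DefinableFun L t) : A.DefinableFun L (fun v => f (t v)) :=
  hf.comp (g := fun v _ => t v) (fun _ => ht)

/-- A definable function remains definable when the extra variable `none` is added. -/
theorem definableFun_lift {t : (α → R) → R} (ht : A.DefinableFun L t) :
    A.DefinableFun L (fun w : Option α → R => t (w ∘ some)) :=
  Definable.preimage_comp (s := Function.tupleGraph t)
    (fun o : Option α => o.elim none (fun i => some (some i))) ht

section Group

variable [AddCommGroup R]

theorem definableFun_add (hadd : AddDefinable L R A) {s t : (α → R) → R}
    (hs : A.DefinableFun L s) (ht : A.DefinableFun L t) :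
    A.DefinableFun L (fun v => s v + t v) := by
  have hF : A.DefinableMap L
      (fun w : Option α → R => ![s (w ∘ some), t (w ∘ some), w none]) := by
    intro i
    fin_cases i
    · exact definableFun_lift hs
    · exact definableFun_lift ht
    · exact DefinableFun.proj L
  exact Definable.preimage_map hF hadd

theorem definableFun_neg (hadd : AddDefinable L R A) {t : (α → R) → R}
    (ht : A.DefinableFun L t) : A.DefinableFun L (fun v => - t v) := by
  have hn : A.DefinableFun L (fun w : Option α → R => w none) := DefinableFun.proj L
  -- The equation avoids the constant `0`, which need not belong to `A`.
  have h := (definableFun_add hadd (definableFun_add hadd (definableFun_lift ht) hn) hn).ofPred_eq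
    hn
  unfold DefinableFun
  convert h using 1
  ext w
  simp only [Function.tupleGraph, mem_ofPred_eq, add_eq_right]
  exact neg_eq_iff_add_eq_zero

theorem definableFun_sub (hadd : AddDefinable L R A) {s t : (α → R) → R}
    (hs : A.DefinableFun L s) (ht : A.DefinableFun L t) :
    A.DefinableFun L (fun v => s v - t v) := by
  simpa only [sub_eq_add_neg] using definableFun_add hadd hs (definableFun_neg hadd ht)

theorem neg_mem_acl (hadd : AddDefinable L R A) {a : R} (ha : a ∈ acl L R A) :
    -a ∈ acl L R A := by
  obtain ⟨s, hs, hfin, has⟩ := ha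
  refine ⟨-s, ?_, hfin.neg, by simpa using has⟩
  exact definable_pred hs (definableFun_neg hadd (DefinableFun.proj L))

end Group

/-- `IsReduct` concerns the variables `Fin n`; this is its extension to finite index types. -/
theorem definable_of_reduct {L' : FirstOrder.Language} [L'.Structure R] (hred : IsReduct L L' R)
    [Finite α] {S : Set (α → R)} (hS : (univ : Set R).Definable L S) :
    (univ : Set R).Definable L' S := by
  obtain ⟨n, ⟨e⟩⟩ := Finite.exists_equiv_fin α
  have h := (hred n _ (hS.preimage_comp e)).preimage_comp e.symm
  convert h using 1
  ext v
  simp [Function.comp_def]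

theorem definableFun_of_reduct {L' : FirstOrder.Language} [L'.Structure R]
    (hred : IsReduct L L' R) [Finite α] {t : (α → R) → R}
    (ht : (univ : Set R).DefinableFun L t) : (univ : Set R).DefinableFun L' t :=
  definable_of_reduct hred ht

end Definability

/-! ### Finite unions of order-connected sets -/

section Order

variable {R : Type*} [LinearOrder R]

theorem IsCell.ordConnected {c : Set R} (hc : IsCell c) : c.OrdConnected := by
  cases hc <;> infer_instance

theorem IsCell.exists_isLUB [DenselyOrdered R] [NoMaxOrder R] {c : Set R} (hc : IsCell c)
    (hne : c.Nonempty) (hb : BddAbove c) : ∃ b, IsLUB c b := by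
  cases hc with
  | point a => exact ⟨a, isLUB_singleton⟩
  | ioo a b =>
    obtain ⟨x, hx⟩ := hne
    exact ⟨b, isLUB_Ioo (hx.1.trans hx.2)⟩
  | iio b =>
    obtain ⟨x, hx⟩ := hne
    refine ⟨b, fun y hy => le_of_lt hy, fun y hy => le_of_forall_lt_imp_le_of_dense ?_⟩
    exact fun z hz => hy hz
  | ioi a => exact absurd hb (not_bddAbove_Ioi a)
  | univ =>
    obtain ⟨m, hm⟩ := hb
    obtain ⟨y, hy⟩ := exists_gt m
    exact absurd (hm (mem_univ y)) (not_le.2 hy)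

theorem exists_isLUB_sUnion_cells [DenselyOrdered R] [NoMaxOrder R] {C : Set (Set R)}
    (hfin : C.Finite) (hC : ∀ c ∈ C, IsCell c) (hne : (⋃₀ C).Nonempty) (hb : BddAbove (⋃₀ C)) :
    ∃ b, IsLUB (⋃₀ C) b := by
  induction C, hfin using Set.Finite.induction_on with
  | empty => simp at hne
  | @insert c C hc _ ih =>
    rw [sUnion_insert] at hne hb ⊢
    have hb' := bddAbove_union.1 hb
    have ih' := ih (fun d hd => hC d (mem_insert_of_mem _ hd))
    have hcell := hC c (mem_insert _ _)
    rcases c.eq_empty_or_nonempty with rfl | hcn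
    · simp only [empty_union] at hne ⊢
      exact ih' hne hb'.2
    obtain ⟨b, hb₁⟩ := hcell.exists_isLUB hcn hb'.1
    rcases (⋃₀ C).eq_empty_or_nonempty with h | h
    · exact ⟨b, by simpa [h] using hb₁⟩
    · obtain ⟨b', hb₂⟩ := ih' h hb'.2
      exact ⟨b ⊔ b', hb₁.union hb₂⟩

theorem eventually_atTop_of_frequently [Nonempty R] [NoMaxOrder R] {c : Set R}
    (hc : c.OrdConnected) (h : ∃ᶠ x in atTop, x ∈ c) : ∀ᶠ x in atTop, x ∈ c := by
  obtain ⟨a, ha⟩ := h.exists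
  filter_upwards [eventually_ge_atTop a] with y hy
  obtain ⟨b, hb, hyb⟩ := (h.and_eventually (eventually_ge_atTop y)).exists
  exact hc.out ha hb ⟨hy, hyb⟩

theorem eventually_nhdsLT_of_frequently [TopologicalSpace R] [OrderTopology R] {c : Set R}
    (hc : c.OrdConnected) {b : R} (h : ∃ᶠ x in 𝓝[<] b, x ∈ c) : ∀ᶠ x in 𝓝[<] b, x ∈ c := by
  obtain ⟨a, ha, hab⟩ := (h.and_eventually self_mem_nhdsWithin).exists
  filter_upwards [Ioo_mem_nhdsLT hab] with y hy
  obtain ⟨x, hx, hyx⟩ := (h.and_eventually (Ioo_mem_nhdsLT hy.2)).exists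
  exact hc.out ha hx ⟨hy.1.le, hyx.1.le⟩

/-- By the pigeonhole principle, one member of `C` is met frequently. -/
theorem eventually_sUnion_of_frequently {β : Type*} {l : Filter β} {C : Set (Set β)}
    (hfin : C.Finite) (hl : ∀ c ∈ C, (∃ᶠ x in l, x ∈ c) → ∀ᶠ x in l, x ∈ c)
    (h : ∃ᶠ x in l, x ∈ ⋃₀ C) :
    ∀ᶠ x in l, x ∈ ⋃₀ C := by
  have : ∃ c ∈ C, ∃ᶠ x in l, x ∈ c := by
    by_contra! hcon
    refine h ?_
    filter_upwards [(eventually_all_finite hfin).2 hcon] with x hx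
    rintro ⟨c, hc, hxc⟩
    exact hx c hc hxc
  obtain ⟨c, hc, hcl⟩ := this
  exact (hl c hc hcl).mono fun x hx => ⟨c, hc, hx⟩

end Order

/-! ### Definable sets and functions in o-minimal structures -/

section OMinimal

variable {R : Type*} [LinearOrder R] {L : FirstOrder.Language} [L.Structure R]

theorem IsOMinimal.eventually_atTop_of_frequently [Nonempty R] [NoMaxOrder R]
    (homin : IsOMinimal L R) {s : Set R} (hs : (univ : Set R).Definable₁ L s)
    (h : ∃ᶠ x in atTop, x ∈ s) : ∀ᶠ x in atTop, x ∈ s := by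
  obtain ⟨C, hfin, hC, rfl⟩ := homin s hs
  exact eventually_sUnion_of_frequently hfin
    (fun c hc => StronglyBounded.eventually_atTop_of_frequently (hC c hc).ordConnected) h

theorem IsOMinimal.eventually_nhdsLT_of_frequently [TopologicalSpace R] [OrderTopology R]
    (homin : IsOMinimal L R) {s : Set R} (hs : (univ : Set R).Definable₁ L s) {b : R}
    (h : ∃ᶠ x in 𝓝[<] b, x ∈ s) : ∀ᶠ x in 𝓝[<] b, x ∈ s := by
  obtain ⟨C, hfin, hC, rfl⟩ := homin s hs
  exact eventually_sUnion_of_frequently hfin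
    (fun c hc => StronglyBounded.eventually_nhdsLT_of_frequently (hC c hc).ordConnected) h

theorem IsOMinimal.exists_isLUB [DenselyOrdered R] [NoMaxOrder R]
    (homin : IsOMinimal L R) {s : Set R} (hs : (univ : Set R).Definable₁ L s)
    (hne : s.Nonempty) (hb : BddAbove s) : ∃ b, IsLUB s b := by
  obtain ⟨C, hfin, hC, rfl⟩ := homin s hs
  exact exists_isLUB_sUnion_cells hfin hC hne hb

/-- A definable function that is bounded near `+∞` has a limit at `+∞`: the supremum of its
eventual strict lower bounds. -/
theorem IsOMinimal.exists_tendsto_atTop [TopologicalSpace R] [OrderTopology R]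
    [DenselyOrdered R] [NoMaxOrder R] [NoMinOrder R] [Nonempty R]
    (hlt : LtDefinable L R univ) (homin : IsOMinimal L R) {f : R → R}
    (hf : (univ : Set R).DefinableFun L (fun v : Fin 1 → R => f (v 0))) {m M : R}
    (hm : ∀ᶠ x in atTop, m ≤ f x) (hM : ∀ᶠ x in atTop, f x ≤ M) :
    ∃ l, Tendsto f atTop (𝓝 l) := by
  let S : Set R := {t | ∀ᶠ x in atTop, t < f x}
  have hS : (univ : Set R).Definable₁ L S := by
    have : S = {t | ∃ z, ∀ x, z < x → t < f x} := by
      ext t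
      exact (atTop_basis_Ioi (α := R)).eventually_iff.trans (by simp)
    rw [this]
    refine definable_exists (definable_forall (definable_imp
      (definable_rel hlt ?_ ?_) (definable_rel hlt ?_ (definableFun_comp hf ?_))))
    · exact DefinableFun.proj L (i := some none)
    · exact DefinableFun.proj L (i := none)
    · exact DefinableFun.proj L (i := some (some 0))
    · exact DefinableFun.proj L (i := none)
  have hne : S.Nonempty := by
    obtain ⟨t, ht⟩ := exists_lt m
    exact ⟨t, hm.mono fun x hx => ht.trans_le hx⟩
  have hb : BddAbove S := by
    refine ⟨M, fun t ht => ?_⟩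
    obtain ⟨x, hx, hx'⟩ := (Eventually.and ht hM).exists
    exact hx.le.trans hx'
  obtain ⟨l, hl⟩ := homin.exists_isLUB hS hne hb
  refine ⟨l, tendsto_order.2 ⟨fun a ha => ?_, fun a ha => ?_⟩⟩
  · obtain ⟨t, ht, hat⟩ := (lt_isLUB_iff hl).1 ha
    exact Eventually.mono ht fun x hx => hat.trans hx
  · obtain ⟨b, hlb, hba⟩ := exists_between ha
    have hbS : ¬ ∀ᶠ x in atTop, b < f x := fun h => (hl.1 h).not_gt hlb
    have hd : (univ : Set R).Definable₁ L {x | b < f x} :=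
      definable_rel hlt (definableFun_const b) hf
    have := mt (homin.eventually_atTop_of_frequently hd) hbS
    exact (not_frequently.1 this).mono fun x hx => (not_lt.1 hx).trans_lt hba

/-- If a definable function is positive near `+∞` and tends to a smaller value there, then at
arbitrarily large points `y` its values just to the left of `y` exceed all its values to the
right of `y`. This replaces the monotonicity theorem: failing this, the last point where `f` is
at least `f x` exists for all large `x`, so that arbitrarily large points, hence all large points,
carry a value that exceeds all later ones, and `f` is strictly decreasing near `+∞`. -/
theorem IsOMinimal.frequently_drop [TopologicalSpace R] [OrderTopology R]
    [DenselyOrdered R] [NoMaxOrder R] [NoMinOrder R] [Nonempty R]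
    (hlt : LtDefinable L R univ) (homin : IsOMinimal L R) {f : R → R}
    (hf : (univ : Set R).DefinableFun L (fun v : Fin 1 → R => f (v 0))) {l : R}
    (hpos : ∀ᶠ x in atTop, l < f x) (hlim : Tendsto f atTop (𝓝 l)) :
    ∃ᶠ y in atTop, ∃ u < y, ∀ a ∈ Ioo u y, ∀ b > y, f b < f a := by
  intro hcon
  obtain ⟨z, hz⟩ := (atTop_basis_Ioi (α := R)).eventually_iff.1 (hpos.and hcon)
  have hz' : ∀ y, z < y → l < f y ∧ ¬ ∃ u < y, ∀ a ∈ Ioo u y, ∀ b > y, f b < f a :=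
    fun y hy => hz.2 hy
  have hZ : ∃ᶠ x in atTop, x ∈ {x | ∀ y, x < y → f y < f x} := by
    rw [frequently_atTop]
    intro z₁
    obtain ⟨x, hx⟩ := exists_gt (z ⊔ z₁)
    have hzx : z < x := le_sup_left.trans_lt hx
    let E : Set R := {y | ¬ y < x ∧ ¬ f y < f x}
    have hE : (univ : Set R).Definable₁ L E :=
      definable_and (definable_not (definable_rel hlt (DefinableFun.proj L (i := 0))
        (definableFun_const x)))
        (definable_not (definable_rel hlt hf (definableFun_const (f x))))
    have hxE : x ∈ E := ⟨lt_irrefl _, lt_irrefl _⟩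
    obtain ⟨w, hw⟩ := eventually_atTop.1 ((tendsto_order.1 hlim).2 (f x) (hz' x hzx).1)
    have hb : BddAbove E :=
      ⟨w, fun y hy => le_of_not_ge fun hwy => hy.2 (hw y hwy)⟩
    obtain ⟨β, hβ⟩ := homin.exists_isLUB hE ⟨x, hxE⟩ hb
    have hxβ : x ≤ β := hβ.1 hxE
    have hright : ∀ y, β < y → f y < f x := by
      intro y hy
      by_contra hcon
      exact (hβ.1 (show y ∈ E from ⟨(hxβ.trans hy.le).not_gt, hcon⟩)).not_gt hy
    refine ⟨β, (le_sup_right.trans hx.le).trans hxβ, ?_⟩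
    -- Otherwise `E` accumulates at `β` from the left, and `f` drops at `β`.
    have hβx : f x ≤ f β := by
      by_contra hlt'
      have hfreq : ∃ᶠ y in 𝓝[<] β, y ∈ E := by
        intro hnot
        obtain ⟨u, hu, huE⟩ := mem_nhdsLT_iff_exists_Ioo_subset.1 hnot
        refine hu.not_ge (hβ.2 fun y hy => ?_)
        by_contra! huy
        rcases (hβ.1 hy).lt_or_eq with h | rfl
        · exact huE ⟨huy, h⟩ hy
        · exact hlt' (not_lt.1 hy.2)
      have hev := homin.eventually_nhdsLT_of_frequently hE hfreq
      obtain ⟨u, hu, huE⟩ := mem_nhdsLT_iff_exists_Ioo_subset.1 hev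
      exact (hz' β (hzx.trans_le hxβ)).2
        ⟨u, hu, fun a ha b hb => (hright b hb).trans_le (not_lt.1 (huE ha).2)⟩
    exact fun y hy => (hright y hy).trans_le hβx
  have hZd : (univ : Set R).Definable₁ L {x | ∀ y, x < y → f y < f x} :=
    definable_forall (definable_imp
      (definable_rel hlt (DefinableFun.proj L (i := some 0)) (DefinableFun.proj L (i := none)))
      (definable_rel hlt (definableFun_comp hf (DefinableFun.proj L (i := none)))
        (definableFun_comp hf (DefinableFun.proj L (i := some 0)))))
  obtain ⟨w, hw⟩ := eventually_atTop.1 (homin.eventually_atTop_of_frequently hZd hZ)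
  obtain ⟨y, hy⟩ := exists_gt (w ⊔ z)
  exact (hz' y (le_sup_right.trans_lt hy)).2 ⟨w, le_sup_left.trans_lt hy,
    fun a ha b hb => hw a ha.1.le b (ha.2.trans hb)⟩

/-- The subgroup of doubles is definable and unbounded, so it contains a half-line. -/
theorem IsOMinimal.exists_add_self [AddCommGroup R] [IsOrderedAddMonoid R] [Nontrivial R]
    (hadd : AddDefinable L R univ) (homin : IsOMinimal L R) (x : R) : ∃ y, y + y = x := by
  have hd : (univ : Set R).Definable₁ L {x | ∃ y, y + y = x} :=
    definable_exists ((definableFun_add hadd (DefinableFun.proj L (i := none))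
      (DefinableFun.proj L (i := none))).ofPred_eq (DefinableFun.proj L (i := some 0)))
  have hfreq : ∃ᶠ x in atTop, x ∈ {x : R | ∃ y, y + y = x} := by
    rw [frequently_atTop]
    intro z
    refine ⟨(z ⊔ 0) + (z ⊔ 0), ?_, _, rfl⟩
    exact le_add_of_le_of_nonneg le_sup_left le_sup_right
  obtain ⟨a, ha⟩ := eventually_atTop.1 (homin.eventually_atTop_of_frequently hd hfreq)
  obtain ⟨p, hp⟩ := ha (a ⊔ (a - x)) le_sup_left
  obtain ⟨q, hq⟩ := ha ((a ⊔ (a - x)) + x) (sub_le_iff_le_add.1 le_sup_right)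
  refine ⟨q - p, ?_⟩
  rw [sub_add_sub_comm, hp, hq, add_sub_cancel_left]

/-- Half of `a + b` lies between `a` and `b`. -/
theorem IsOMinimal.denselyOrdered [AddCommGroup R] [IsOrderedAddMonoid R] [Nontrivial R]
    (hadd : AddDefinable L R univ) (homin : IsOMinimal L R) : DenselyOrdered R := by
  refine ⟨fun a b hab => ?_⟩
  obtain ⟨y, hy⟩ := homin.exists_add_self hadd (a + b)
  refine ⟨y, ?_, ?_⟩
  · by_contra! h
    exact (add_lt_add_of_le_of_lt h (h.trans_lt hab)).ne hy
  · by_contra! h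
    exact (add_lt_add_of_lt_of_le (hab.trans_le h) h).ne' hy

end OMinimal

/-! ### Strongly bounded reducts -/

section StronglyBounded

variable {R : Type*} [LinearOrder R] [AddCommGroup R] {L : FirstOrder.Language} [L.Structure R]

/-- The restriction of the strict order to the interval `(-c, c)`, as a relation on `R`. -/
def ltOn (c : R) : Set (R × R) := {p | p.1 ∈ Ioo (-c) c ∧ p.2 ∈ Ioo (-c) c ∧ p.1 < p.2}

/-- The points `y` such that, for a scale `d < c`, the values of `f` on `(y - d, y)` exceed those
on `(y, y + d)`. Differences of points and values of `f` are compared by `ltOn c` only, so the set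
is definable wherever addition, `f` and the order on `(-c, c)` are. -/
def localDrop (c : R) (f : R → R) : Set R :=
  {y | ∃ d, (0, d) ∈ ltOn c ∧ ∀ a, (0, a) ∈ ltOn c → (a, d) ∈ ltOn c →
    ∀ b, (0, b) ∈ ltOn c → (b, d) ∈ ltOn c → (f (y + b), f (y - a)) ∈ ltOn c}

theorem definable_localDrop (hadd : AddDefinable L R univ) {c : R}
    (hc : (univ : Set R).Definable₂ L (ltOn c)) {f : R → R}
    (hf : (univ : Set R).DefinableFun L (fun v : Fin 1 → R => f (v 0))) :
    (univ : Set R).Definable₁ L (localDrop c f) := by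
  refine definable_exists (definable_and ?_ (definable_forall (definable_imp ?_ (definable_imp ?_
    (definable_forall (definable_imp ?_ (definable_imp ?_ ?_)))))))
  · exact definable_rel hc (definableFun_const 0) (DefinableFun.proj L (i := none))
  · exact definable_rel hc (definableFun_const 0) (DefinableFun.proj L (i := none))
  · exact definable_rel hc (DefinableFun.proj L (i := none)) (DefinableFun.proj L (i := some none))
  · exact definable_rel hc (definableFun_const 0) (DefinableFun.proj L (i := none))
  · exact definable_rel hc (DefinableFun.proj L (i := none))
      (DefinableFun.proj L (i := some (some none)))
  · refine definable_rel hc (definableFun_comp hf (definableFun_add hadd ?_ ?_))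
      (definableFun_comp hf (definableFun_sub hadd ?_ ?_))
    · exact DefinableFun.proj L (i := some (some (some 0)))
    · exact DefinableFun.proj L (i := none)
    · exact DefinableFun.proj L (i := some (some (some 0)))
    · exact DefinableFun.proj L (i := some none)

/-- The second hypothesis says that, near `y`, values to the left are smaller than values to the
right: `localDrop` of the reflected function is read at `-y`. -/
theorem disjoint_localDrop [DenselyOrdered R] {c : R} {f : R → R} {y : R} (hy : y ∈ localDrop c f)
    (hy' : -y ∈ localDrop c (fun x => f (-x))) : False := by
  obtain ⟨d, ⟨hc, hd, hd₀⟩, h⟩ := hy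
  obtain ⟨d', ⟨-, hd', hd₀'⟩, h'⟩ := hy'
  obtain ⟨a, ha, had⟩ := exists_between (lt_min hd₀ hd₀')
  obtain ⟨had, had'⟩ := lt_min_iff.1 had
  have hac : a ∈ Ioo (-c) c := ⟨hc.1.trans ha, had.trans hd.2⟩
  have h₁ := (h a ⟨hc, hac, ha⟩ ⟨hac, hd, had⟩ a ⟨hc, hac, ha⟩ ⟨hac, hd, had⟩).2.2
  have h₂ := (h' a ⟨hc, hac, ha⟩ ⟨hac, hd', had'⟩ a ⟨hc, hac, ha⟩ ⟨hac, hd', had'⟩).2.2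
  simp only [neg_add_rev, neg_neg, neg_sub, sub_neg_eq_add] at h₂
  rw [neg_add_eq_sub, add_comm a y] at h₂
  exact lt_asymm h₁ h₂

variable [IsOrderedAddMonoid R]

theorem CoBounded.eventually_atTop [Nontrivial R] {s : Set R} (hs : CoBounded s) :
    ∀ᶠ x in atTop, x ∈ s := by
  obtain ⟨b, hb⟩ := hs.2
  filter_upwards [eventually_gt_atTop b] with x hx
  by_contra h
  exact (hb h).not_gt hx

theorem CoBounded.eventually_neg_atTop [Nontrivial R] {s : Set R} (hs : CoBounded s) :
    ∀ᶠ x in atTop, -x ∈ s := by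
  obtain ⟨b, hb⟩ := hs.1
  filter_upwards [eventually_gt_atTop (-b)] with x hx
  by_contra h
  exact (hb h).not_gt (neg_lt.1 hx)

theorem coBounded_of_eventually {s : Set R} (h : ∀ᶠ x in atTop, x ∈ s)
    (h' : ∀ᶠ x in atTop, -x ∈ s) : CoBounded s := by
  obtain ⟨a, ha⟩ := eventually_atTop.1 h
  obtain ⟨b, hb⟩ := eventually_atTop.1 h'
  refine ⟨⟨-b, fun x hx => ?_⟩, ⟨a, fun x hx => ?_⟩⟩
  · by_contra! hlt
    exact hx (by simpa using hb (-x) (le_neg.1 hlt.le))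
  · by_contra! hlt
    exact hx (ha x hlt.le)

theorem IsStronglyBounded.coBounded_of_frequently [Nontrivial R] (hsb : IsStronglyBounded L R)
    {s : Set R} (hs : (univ : Set R).Definable₁ L s) (h : ∃ᶠ x in atTop, x ∈ s) :
    CoBounded s := by
  refine (hsb s hs).resolve_left fun hb => ?_
  obtain ⟨b, hb⟩ := hb.2
  obtain ⟨x, hx, hbx⟩ := (h.and_eventually (eventually_gt_atTop b)).exists
  exact (hb hx).not_gt hbx

/-- Far enough to the right, points at distance less than `c` have values in `(-c, c)`, where
`ltOn c` is the order. -/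
theorem frequently_mem_localDrop [Nontrivial R] [DenselyOrdered R] {c : R} (hc : 0 < c)
    {f : R → R} (hf : ∀ᶠ x in atTop, f x ∈ Ioo (-c) c)
    (h : ∃ᶠ y in atTop, ∃ u < y, ∀ a ∈ Ioo u y, ∀ b > y, f b < f a) :
    ∃ᶠ y in atTop, y ∈ localDrop c f := by
  obtain ⟨z, hz⟩ := eventually_atTop.1 hf
  refine (h.and_eventually (eventually_ge_atTop (z + c))).mono ?_
  rintro y ⟨⟨u, huy, hu⟩, hzy⟩
  obtain ⟨d, hd, hdm⟩ := exists_between (lt_min hc (sub_pos.2 huy))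
  obtain ⟨hdc, hdu⟩ := lt_min_iff.1 hdm
  have hc' : -c < 0 := neg_lt_zero.2 hc
  refine ⟨d, ⟨⟨hc', hc⟩, ⟨hc'.trans hd, hdc⟩, hd⟩, fun a ha had b hb _ => ?_⟩
  have ha₀ : 0 < a := ha.2.2
  have hb₀ : 0 < b := hb.2.2
  have had' : a < d := had.2.2
  refine ⟨hz _ ?_, hz _ ?_, hu _ ⟨?_, ?_⟩ _ ?_⟩
  · exact (le_add_of_nonneg_right hc.le).trans (hzy.trans (le_add_of_nonneg_right hb₀.le))
  · exact le_sub_iff_add_le.2 ((add_le_add_right (had'.trans hdc).le z).trans hzy)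
  · exact lt_sub_comm.1 (had'.trans hdu)
  · exact sub_lt_self y ha₀
  · exact lt_add_of_pos_right y hb₀

section Reduct

variable [TopologicalSpace R] [OrderTopology R] [Nontrivial R] [DenselyOrdered R]
  {L' : FirstOrder.Language} [L'.Structure R]

/-- A definable function cannot tend to `0` from above at both ends of the line: near `+∞` its
values drop locally, near `-∞` they rise locally, and by strong boundedness both happen at all
points off a bounded set. -/
theorem IsStronglyBounded.not_pos_of_tendsto_zero
    (hlt : LtDefinable L' R univ) (homin : IsOMinimal L' R)
    (hadd : AddDefinable L R univ) (hred : IsReduct L L' R) (hsb : IsStronglyBounded L R)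
    {c : R} (hc : 0 < c) (hcd : (univ : Set R).Definable₂ L (ltOn c)) {f : R → R}
    (hf : (univ : Set R).DefinableFun L (fun v : Fin 1 → R => f (v 0)))
    (htop : Tendsto f atTop (𝓝 0)) (hbot : Tendsto (fun x => f (-x)) atTop (𝓝 0))
    (hpos : CoBounded {x | (0, f x) ∈ ltOn c}) : False := by
  have hf' : (univ : Set R).DefinableFun L (fun v : Fin 1 → R => f (-v 0)) :=
    definableFun_comp hf (definableFun_neg hadd (DefinableFun.proj L))
  have h₁ : CoBounded (localDrop c f) := by
    refine hsb.coBounded_of_frequently (definable_localDrop hadd hcd hf)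
      (frequently_mem_localDrop hc (hpos.eventually_atTop.mono fun x hx => hx.2.1)
        (homin.frequently_drop hlt (definableFun_of_reduct hred hf)
          (hpos.eventually_atTop.mono fun x hx => hx.2.2) htop))
  have h₂ : CoBounded (localDrop c (fun x => f (-x))) := by
    refine hsb.coBounded_of_frequently (definable_localDrop hadd hcd hf')
      (frequently_mem_localDrop hc (hpos.eventually_neg_atTop.mono fun x hx => hx.2.1)
        (homin.frequently_drop hlt (definableFun_of_reduct hred hf')
          (hpos.eventually_neg_atTop.mono fun x hx => hx.2.2) hbot))
  obtain ⟨y, hy, hy'⟩ := (h₁.eventually_atTop.and h₂.eventually_neg_atTop).exists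
  exact disjoint_localDrop hy hy'

/-- The limits at the two ends of the line agree: otherwise a short interval around one of them
has a preimage that contains one end of the line and misses the other. -/
theorem IsStronglyBounded.tendsto_unique
    (hadd : AddDefinable L R univ) (hsb : IsStronglyBounded L R)
    {c : R} (hc : 0 < c) (hcd : (univ : Set R).Definable₂ L (ltOn c)) {f : R → R}
    (hf : (univ : Set R).DefinableFun L (fun v : Fin 1 → R => f (v 0))) {l l' : R}
    (htop : Tendsto f atTop (𝓝 l)) (hbot : Tendsto (fun x => f (-x)) atTop (𝓝 l')) :
    l = l' := by
  have key : ∀ V ∈ 𝓝 l, ∃ e, 0 < e ∧ e < c ∧ Ioo (l - e) (l + e) ⊆ V := by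
    intro V hV
    obtain ⟨ε, hε, hεV⟩ := (nhds_basis_Ioo_pos l).mem_iff.1 hV
    obtain ⟨e, he, hem⟩ := exists_between (lt_min hc hε)
    obtain ⟨hec, heε⟩ := lt_min_iff.1 hem
    exact ⟨e, he, hec, (Ioo_subset_Ioo (sub_le_sub_left heε.le l)
      (add_le_add_right heε.le l)).trans hεV⟩
  by_contra hne
  obtain ⟨U, V, hU, hV, hUV⟩ := t2_separation_nhds hne
  obtain ⟨e, he, hec, heU⟩ := key U hU
  have hc' : -c < 0 := neg_lt_zero.2 hc
  let s : Set R := {x | (-e, f x - l) ∈ ltOn c ∧ (f x - l, e) ∈ ltOn c}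
  have hs : (univ : Set R).Definable₁ L s :=
    definable_and
      (definable_rel hcd (definableFun_const _) (definableFun_sub hadd hf (definableFun_const l)))
      (definable_rel hcd (definableFun_sub hadd hf (definableFun_const l)) (definableFun_const _))
  have hsU : ∀ x ∈ s, f x ∈ U := fun x hx => heU ⟨by
    have := hx.1.2.2
    rwa [lt_sub_iff_add_lt, neg_add_eq_sub] at this, sub_lt_iff_lt_add'.1 hx.2.2.2⟩
  have hsev : ∀ᶠ x in atTop, x ∈ s := by
    filter_upwards [htop (Ioo_mem_nhds (sub_lt_self l he) (lt_add_of_pos_right l he))] with x hx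
    have h₁ : -e < f x - l := by
      rw [lt_sub_iff_add_lt, neg_add_eq_sub]
      exact hx.1
    have h₂ : f x - l < e := sub_lt_iff_lt_add'.2 hx.2
    have he₁ : -e ∈ Ioo (-c) c := ⟨neg_lt_neg hec, (neg_lt_zero.2 he).trans hc⟩
    have he₂ : e ∈ Ioo (-c) c := ⟨hc'.trans he, hec⟩
    have hx' : f x - l ∈ Ioo (-c) c := ⟨he₁.1.trans h₁, h₂.trans hec⟩
    exact ⟨⟨he₁, hx', h₁⟩, ⟨hx', he₂, h₂⟩⟩
  have hco := hsb.coBounded_of_frequently hs hsev.frequently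
  obtain ⟨x, hx, hxV⟩ := (hco.eventually_neg_atTop.and (hbot hV)).exists
  exact disjoint_left.1 hUV (hsU _ hx) hxV

/-- Near `+∞` the difference `f x - l` lies in `(-c, c)`, so one of the definable conditions
`f x = l`, `0 < f x - l < c`, `-c < f x - l < 0` holds on a co-bounded set; the last two are
excluded by `not_pos_of_tendsto_zero`. -/
theorem IsStronglyBounded.coBounded_eq_of_tendsto
    (hlt : LtDefinable L' R univ) (homin : IsOMinimal L' R)
    (hadd : AddDefinable L R univ) (hred : IsReduct L L' R) (hsb : IsStronglyBounded L R)
    {c : R} (hc : 0 < c) (hcd : (univ : Set R).Definable₂ L (ltOn c)) {f : R → R}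
    (hf : (univ : Set R).DefinableFun L (fun v : Fin 1 → R => f (v 0))) {l : R}
    (htop : Tendsto f atTop (𝓝 l)) (hbot : Tendsto (fun x => f (-x)) atTop (𝓝 l)) :
    CoBounded {x | f x = l} := by
  have hh : (univ : Set R).DefinableFun L (fun v : Fin 1 → R => f (v 0) - l) :=
    definableFun_sub hadd hf (definableFun_const l)
  have hh' : (univ : Set R).DefinableFun L (fun v : Fin 1 → R => -(f (v 0) - l)) :=
    definableFun_neg hadd hh
  have htop₀ : Tendsto (fun x => f x - l) atTop (𝓝 0) := by simpa using htop.sub_const l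
  have hbot₀ : Tendsto (fun x => f (-x) - l) atTop (𝓝 0) := by simpa using hbot.sub_const l
  have h₁ : ¬ CoBounded {x | (0, f x - l) ∈ ltOn c} :=
    hsb.not_pos_of_tendsto_zero hlt homin hadd hred hc hcd hh htop₀ hbot₀
  have h₂ : ¬ CoBounded {x | (0, -(f x - l)) ∈ ltOn c} :=
    hsb.not_pos_of_tendsto_zero hlt homin hadd hred hc hcd hh' (by simpa using htop₀.neg)
      (by simpa using hbot₀.neg)
  have hd₀ : (univ : Set R).Definable₁ L {x | f x = l} := hf.ofPred_eq (definableFun_const l)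
  have hd₁ : (univ : Set R).Definable₁ L {x | (0, f x - l) ∈ ltOn c} :=
    definable_rel hcd (definableFun_const 0) hh
  have hd₂ : (univ : Set R).Definable₁ L {x | (0, -(f x - l)) ∈ ltOn c} :=
    definable_rel hcd (definableFun_const 0) hh'
  by_contra h₀
  have e₀ := not_frequently.1 (mt (hsb.coBounded_of_frequently hd₀) h₀)
  have e₁ := not_frequently.1 (mt (hsb.coBounded_of_frequently hd₁) h₁)
  have e₂ := not_frequently.1 (mt (hsb.coBounded_of_frequently hd₂) h₂)
  have hc' : -c < 0 := neg_lt_zero.2 hc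
  obtain ⟨x, ⟨⟨hx₀, hx₁⟩, hx₂⟩, hx⟩ :=
    (((e₀.and e₁).and e₂).and (htop₀ (Ioo_mem_nhds hc' hc))).exists
  rcases lt_trichotomy (f x - l) 0 with h | h | h
  · exact hx₂ ⟨⟨hc', hc⟩, ⟨neg_lt_neg hx.2, neg_lt.1 hx.1⟩, neg_pos.2 h⟩
  · exact hx₀ (sub_eq_zero.1 h)
  · exact hx₁ ⟨⟨hc', hc⟩, hx, h⟩

end Reduct

end StronglyBounded

end StronglyBounded

theorem mainTheorem11
    {R : Type*} [AddCommGroup R] [LinearOrder R] [IsOrderedAddMonoid R]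
    -- the o-minimal expansion of the ordered group `R`
    (Lomin : FirstOrder.Language) [Lomin.Structure R]
    (hlt : StronglyBounded.LtDefinable Lomin R Set.univ)
    (hadd : StronglyBounded.AddDefinable Lomin R Set.univ)
    (homin : StronglyBounded.IsOMinimal Lomin R)
    -- the strongly bounded additive reduct
    (L : FirstOrder.Language) [L.Structure R]
    (haddL : StronglyBounded.AddDefinable L R ∅)
    (hred : StronglyBounded.IsReduct L Lomin R)
    (hsb : StronglyBounded.IsStronglyBounded L R)
    (hacl : ∃ c ∈ StronglyBounded.acl L R ∅, c ≠ 0)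
    (hltI : StronglyBounded.LtDefinableOnEmptyIntervals L R)
    -- the partial function
    (g : R →. R)
    (hg : (Set.univ : Set R).Definable₂ L {p : R × R | p.2 ∈ g p.1})
    (hdom : StronglyBounded.CoBounded g.Dom)
    (hran : StronglyBounded.Bounded g.ran) :
    ∃ S : Set R, StronglyBounded.CoBounded S ∧ ∃ c : R, ∀ x ∈ S, c ∈ g x := by
  classical
  open StronglyBounded Set Filter Topology in
  obtain ⟨c₀, hc₀, hne⟩ := hacl
  have : Nontrivial R := ⟨c₀, 0, hne⟩
  let : TopologicalSpace R := Preorder.topology R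
  have : OrderTopology R := ⟨rfl⟩
  have : DenselyOrdered R := homin.denselyOrdered hadd
  have haddU : AddDefinable L R univ := haddL.mono (empty_subset _)
  obtain ⟨c, hc, hcpos⟩ : ∃ c ∈ acl L R ∅, 0 < c := by
    rcases hne.lt_or_gt with h | h
    · exact ⟨-c₀, neg_mem_acl haddL hc₀, neg_pos.2 h⟩
    · exact ⟨c₀, hc₀, h⟩
  have hcd : (univ : Set R).Definable₂ L (ltOn c) :=
    Definable.mono (hltI (-c) (neg_mem_acl haddL hc) c hc) (empty_subset _)
  -- The value `0` off the domain makes `g` total; it does not affect the behaviour at the ends.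
  let f : R → R := fun x => if h : (g x).Dom then (g x).get h else 0
  have hfg : ∀ x ∈ g.Dom, f x ∈ g x := by
    intro x hx
    have hx' : (g x).Dom := hx
    simp only [f, dif_pos hx']
    exact Part.get_mem hx'
  have hf : (univ : Set R).DefinableFun L (fun v : Fin 1 → R => f (v 0)) := by
    have hd : (univ : Set R).Definable L
        {w : Option (Fin 1) → R | (w (some 0), w none) ∈ {p : R × R | p.2 ∈ g p.1} ∨
          ((¬ ∃ y, (w (some 0), y) ∈ {p : R × R | p.2 ∈ g p.1}) ∧ w none = 0)} :=
      definable_or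
        (definable_rel hg (DefinableFun.proj L (i := some 0)) (DefinableFun.proj L (i := none)))
        (definable_and
          (definable_not (definable_exists (definable_rel hg
            (DefinableFun.proj L (i := some (some 0))) (DefinableFun.proj L (i := none)))))
          ((DefinableFun.proj L (i := none)).ofPred_eq (definableFun_const 0)))
    unfold DefinableFun
    convert hd using 1
    ext w
    simp only [Function.tupleGraph, mem_ofPred_eq, ← Part.dom_iff_mem, Function.comp_apply, f]
    split_ifs with h
    · simp [h, Part.get_eq_iff_mem]
    · simp [Part.eq_none_iff'.2 h, eq_comm]
  have hbd : ∀ x ∈ g.Dom, f x ∈ g.ran := fun x hx => ⟨x, hfg x hx⟩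
  obtain ⟨⟨m, hm⟩, ⟨M, hM⟩⟩ := hran
  have hf' : (univ : Set R).DefinableFun L (fun v : Fin 1 → R => f (-v 0)) :=
    definableFun_comp hf (definableFun_neg haddU (DefinableFun.proj L))
  obtain ⟨l, hl⟩ := homin.exists_tendsto_atTop hlt (definableFun_of_reduct hred hf)
    (hdom.eventually_atTop.mono fun x hx => hm (hbd x hx))
    (hdom.eventually_atTop.mono fun x hx => hM (hbd x hx))
  obtain ⟨l', hl'⟩ := homin.exists_tendsto_atTop hlt (definableFun_of_reduct hred hf')
    (hdom.eventually_neg_atTop.mono fun x hx => hm (hbd _ hx))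
    (hdom.eventually_neg_atTop.mono fun x hx => hM (hbd _ hx))
  obtain rfl : l = l' := hsb.tendsto_unique haddU hcpos hcd hf hl hl'
  have hco := hsb.coBounded_eq_of_tendsto hlt homin haddU hred hcpos hcd hf hl hl'
  refine ⟨{x | f x = l} ∩ g.Dom, coBounded_of_eventually
    (hco.eventually_atTop.and hdom.eventually_atTop)
    (hco.eventually_neg_atTop.and hdom.eventually_neg_atTop), l, fun x hx => ?_⟩
  rw [← show f x = l from hx.1]
  exact hfg x hx.2
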